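/- Let $X^n$ be uniformly distributed on $\{-1,1\}^n$ and, for $\rho\in[0,1]$, let $Y^n$ be obtained from $X^n$ by flipping each coordinate independently with probability $\delta=(1-\rho)/2$. For a Boolean function $f:\{-1,1\}^n\to\{-1,1\}$ put $T_\rho f(y^n)=\mathbb{E}\left(f(X^n)\mid Y^n=y^n\right)$. The function $f$ is called $\rho$-self-predicting ($\rho$-SP) if, for every $y^n\in\{-1,1\}^n$ with $T_\rho f(y^n)\neq 0$, one has $f(y^n)=\operatorname{sgn}T_\rho f(y^n)$. Let $h(t)=-t\log_2 t-(1-t)\log_2(1-t)$ denote the binary entropy function. Theorem. For every fixed $\alpha>1$ there is a function $r:\mathbb{N}\to\mathbb{R}$ with $r(n)=o(n)$ as $n\to\infty$ (it may depend on $\alpha$) such that for every $n\ge 2\alpha$ and $\rho=1-\frac{2\alpha}{n}$ (so that $\rho\in[0,1]$), the fraction of $\rho$-SP functions among all $2^{2^n}$ Boolean functions on $n$ variables is at most $$\exp\left(-2^{\,n\cdot h\left(\frac{\alpha-1}{2\alpha}\right)+r(n)}\right).$$ -/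

import Mathlib

open Filter Asymptotics

noncomputable section

namespace SelfPredicting

/-- The Hamming cube `{-1,1}^n`; the alphabet `{-1,1}` is the group of units of `ℤ`. -/
abbrev Cube (n : ℕ) : Type := Fin n → ℤˣ

/-- Boolean functions `f : {-1,1}^n → {-1,1}`. -/
abbrev BoolFun (n : ℕ) : Type := Cube n → ℤˣ

/-- The joint probability mass function `p(x,y)` of the pair `(X,Y)`, where `X` is uniform on the
cube and `Y` is obtained from `X` by flipping each coordinate independently with probability
`δ = (1 - ρ) / 2`. -/
def jointPmf {n : ℕ} (ρ : ℝ) (x y : Cube n) : ℝ :=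
  (1 / 2 : ℝ) ^ n * ∏ i, if y i = x i then 1 - (1 - ρ) / 2 else (1 - ρ) / 2

/-- The marginal probability mass function `p(y)` of `Y`. -/
def marginalPmf {n : ℕ} (ρ : ℝ) (y : Cube n) : ℝ :=
  ∑ x, jointPmf ρ x y

/-- The conditional probability mass function `p(x ∣ y)` of `X` given `Y = y`. -/
def condPmf {n : ℕ} (ρ : ℝ) (x y : Cube n) : ℝ :=
  jointPmf ρ x y / marginalPmf ρ y

/-- The noise operator `T_ρ f (y) = E (f(X) ∣ Y = y)`. -/
def noiseOp {n : ℕ} (ρ : ℝ) (f : BoolFun n) (y : Cube n) : ℝ :=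
  ∑ x, condPmf ρ x y * ((f x : ℤ) : ℝ)

/-- `f` is `ρ`-self-predicting at `y`: it agrees with the optimal predictor `sgn T_ρ f` at `y`
unless the latter is tied. -/
def IsSPAt {n : ℕ} (ρ : ℝ) (f : BoolFun n) (y : Cube n) : Prop :=
  noiseOp ρ f y ≠ 0 → ((f y : ℤ) : ℝ) = Real.sign (noiseOp ρ f y)

/-- `f` is `ρ`-self-predicting: it is so at every point of the cube. -/
def IsSP {n : ℕ} (ρ : ℝ) (f : BoolFun n) : Prop :=
  ∀ y, IsSPAt ρ f y

/-- The fraction of `ρ`-self-predicting functions among all Boolean functions on `n` variables. -/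
def fractionSP (n : ℕ) (ρ : ℝ) : ℝ :=
  (Nat.card {f : BoolFun n // IsSP ρ f} : ℝ) / (Nat.card (BoolFun n) : ℝ)

/-- The binary entropy function, with logarithms in base `2`. -/
def binEnt (t : ℝ) : ℝ :=
  -t * Real.logb 2 t - (1 - t) * Real.logb 2 (1 - t)

end SelfPredicting

end

namespace SelfPredicting

/-! ### Noise kernel, codes and neighbours on the Hamming cube -/

section Cube

variable {n : ℕ}

/-! With `δ = α / n`, the quantity `f y * T_ρ f y` is governed by a ball of constant radius `K`
around `y`. The centre contributes `(1 - δ) ^ n`, and the neighbours, if `j` of them agree with `f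
y`, contribute `(1 - δ) ^ (n - 1) * δ * (2 * j - n)`. For `j ≤ n * (α - 1 - η) / (2 * α)` these sum
to at most `-η * (1 - δ) ^ n`. The points at distance between 2 and `K` contribute a nonpositive
amount at least half of the time, by a sign symmetry, and the mass beyond `K` is too small to
compensate (`localPart_lt`, `not_isSPAt_of_localPart_lt`). So a uniformly random `f` fails at `y`
with probability at least `n.choose j / 2 ^ (n + 1)`, through an event that depends only on the
ball.

On a code of minimum distance greater than `2 * K` these events are independent. The code can have
at least `2 ^ n / (e * n ^ (2 * K))` points, so `fractionSP_le` bounds the fraction by `exp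
(-(n.choose j) / (2 * e * n ^ (2 * K)))`. Stirling's estimate turns the binomial coefficient into an
entropy exponent; the polynomial factor is negligible, and letting `η` tend to 0 gives the `o(n)`
error. -/

theorem prod_ite_eq_pow_hammingDist (a b : ℝ) (x y : Cube n) :
    (∏ i, if y i = x i then a else b) = a ^ (n - hammingDist y x) * b ^ hammingDist y x := by
  have h : (Finset.univ.filter fun i => y i = x i).card = n - hammingDist y x := by
    have := Finset.card_filter_add_card_filter_not (s := Finset.univ) (fun i : Fin n => y i = x i)
    rw [Finset.card_univ, Fintype.card_fin] at this
    unfold hammingDist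
    exact Nat.eq_sub_of_add_eq this
  rw [Finset.prod_ite, Finset.prod_const, Finset.prod_const, h]
  rfl

theorem sum_prod_ite (a b : ℝ) (y : Cube n) :
    ∑ x : Cube n, (∏ i, if y i = x i then a else b) = (a + b) ^ n := by
  have h := Finset.prod_univ_sum (fun _ : Fin n => (Finset.univ : Finset ℤˣ))
    (fun i u => if y i = u then a else b)
  rw [Fintype.piFinset_univ] at h
  rw [← h]
  clear h
  have key : ∀ i : Fin n, (∑ u : ℤˣ, if y i = u then a else b) = a + b := by
    intro i
    rcases Int.units_eq_one_or (y i) with h | h <;> rw [h] <;>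
      simp [UnitsInt.univ, add_comm]
  rw [Finset.prod_congr rfl fun i _ => key i, Finset.prod_const, Finset.card_univ,
    Fintype.card_fin]

theorem sum_pow_hammingDist (a b : ℝ) (y : Cube n) :
    ∑ x : Cube n, a ^ (n - hammingDist y x) * b ^ hammingDist y x = (a + b) ^ n := by
  simp_rw [← prod_ite_eq_pow_hammingDist, sum_prod_ite]

theorem condPmf_eq (ρ : ℝ) (x y : Cube n) :
    condPmf ρ x y =
      (1 - (1 - ρ) / 2) ^ (n - hammingDist y x) * ((1 - ρ) / 2) ^ hammingDist y x := by
  unfold condPmf marginalPmf jointPmf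
  rw [← Finset.mul_sum, sum_prod_ite, prod_ite_eq_pow_hammingDist]
  field_simp
  simp

theorem condPmf_nonneg {ρ : ℝ} (h0 : 0 ≤ ρ) (h1 : ρ ≤ 1) (x y : Cube n) : 0 ≤ condPmf ρ x y := by
  rw [condPmf_eq]
  have : 0 ≤ (1 - ρ) / 2 := by linarith
  have : 0 ≤ 1 - (1 - ρ) / 2 := by linarith
  positivity

/-- The mass that the noise puts at distance more than `K` decays exponentially in `K`. -/
theorem sum_condPmf_far_le {ρ : ℝ} (h0 : 0 ≤ ρ) (h1 : ρ ≤ 1) (K : ℕ) (y : Cube n) :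
    ∑ x with ¬ hammingDist y x ≤ K, condPmf ρ x y ≤ Real.exp (n * ((1 - ρ) / 2)) / 2 ^ K := by
  set δ := (1 - ρ) / 2 with hδ
  have hδ0 : 0 ≤ δ := by rw [hδ]; linarith
  have hδ1 : 0 ≤ 1 - δ := by rw [hδ]; linarith
  rw [le_div_iff₀ (by positivity), Finset.sum_mul]
  -- A Chernoff-type bound: `2 ^ K ≤ 2 ^ d` at every distance `d > K`, and the tilted weights sum to
  -- `(1 + δ) ^ n`.
  calc ∑ x with ¬ hammingDist y x ≤ K, condPmf ρ x y * 2 ^ K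
      ≤ ∑ x with ¬ hammingDist y x ≤ K,
          (1 - δ) ^ (n - hammingDist y x) * (2 * δ) ^ hammingDist y x := by
        apply Finset.sum_le_sum
        intro x hx
        rw [Finset.mem_filter] at hx
        rw [condPmf_eq, mul_pow, mul_assoc, mul_comm (2 ^ hammingDist y x)]
        gcongr
        · norm_num
        · omega
    _ ≤ ∑ x : Cube n, (1 - δ) ^ (n - hammingDist y x) * (2 * δ) ^ hammingDist y x :=
        Finset.sum_le_sum_of_subset_of_nonneg (Finset.filter_subset _ _)
          (fun _ _ _ => by positivity)
    _ = (δ + 1) ^ n := by rw [sum_pow_hammingDist]; ring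
    _ ≤ (Real.exp δ) ^ n := by gcongr; exact Real.add_one_le_exp δ
    _ = Real.exp (n * δ) := by rw [← Real.exp_nat_mul]

/-- Give a point at distance `d` the weight `n ^ (-d)`: each point of the ball weighs at least `n ^
(-m)`, while the whole cube weighs `(1 + 1 / n) ^ n ≤ e`. -/
theorem card_hammingBall_le (hn : 0 < n) (m : ℕ) (y : Cube n) :
    (((Finset.univ.filter fun x : Cube n => hammingDist y x ≤ m).card : ℕ) : ℝ)
      ≤ Real.exp 1 * n ^ m := by
  have hn' : (0 : ℝ) < n := by exact_mod_cast hn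
  have hn1 : (1 : ℝ) ≤ n := by exact_mod_cast hn
  have hinv : (1 / n : ℝ) ≤ 1 := by rw [div_le_one hn']; exact hn1
  rw [← div_le_iff₀ (by positivity)]
  calc (((Finset.univ.filter fun x : Cube n => hammingDist y x ≤ m).card : ℕ) : ℝ) / n ^ m
      = ∑ x with hammingDist y x ≤ m, (1 / n : ℝ) ^ m := by
        rw [Finset.sum_const, nsmul_eq_mul, one_div, inv_pow, div_eq_mul_inv]
    _ ≤ ∑ x with hammingDist y x ≤ m, (1 : ℝ) ^ (n - hammingDist y x) * (1 / n) ^ hammingDist y x := by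
        apply Finset.sum_le_sum
        intro x hx
        rw [Finset.mem_filter] at hx
        rw [one_pow, one_mul]
        exact pow_le_pow_of_le_one (by positivity) hinv hx.2
    _ ≤ ∑ x : Cube n, (1 : ℝ) ^ (n - hammingDist y x) * (1 / n) ^ hammingDist y x :=
        Finset.sum_le_sum_of_subset_of_nonneg (Finset.filter_subset _ _)
          (fun _ _ _ => by positivity)
    _ = (1 / n + 1) ^ n := by rw [sum_pow_hammingDist, add_comm]
    _ ≤ (Real.exp (1 / n)) ^ n := by gcongr; exact Real.add_one_le_exp _
    _ = Real.exp 1 := by rw [← Real.exp_nat_mul]; congr 1; field_simp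

/-- A maximal code of minimum distance greater than `m` is large. -/
theorem exists_code (hn : 0 < n) (m : ℕ) :
    ∃ C : Finset (Cube n), (∀ x ∈ C, ∀ y ∈ C, x ≠ y → m < hammingDist x y) ∧
      (2 : ℝ) ^ n ≤ C.card * (Real.exp 1 * n ^ m) := by
  classical
  obtain ⟨C, hC⟩ := (Set.toFinite {C : Finset (Cube n) |
    ∀ x ∈ C, ∀ y ∈ C, x ≠ y → m < hammingDist x y}).exists_maximal ⟨∅, by simp⟩
  refine ⟨C, hC.prop, ?_⟩
  -- By maximality the balls of radius `m` cover the cube: an uncovered point could be added to the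
  -- code.
  have cover : (Finset.univ : Finset (Cube n)) ⊆
      C.biUnion fun y => Finset.univ.filter fun x => hammingDist y x ≤ m := by
    intro z _
    simp only [Finset.mem_biUnion, Finset.mem_filter, Finset.mem_univ, true_and]
    by_contra! hz
    have hzC : insert z C ∈ {C : Finset (Cube n) |
        ∀ x ∈ C, ∀ y ∈ C, x ≠ y → m < hammingDist x y} := by
      intro x hx y hy hxy
      rw [Finset.mem_insert] at hx hy
      rcases hx with rfl | hx <;> rcases hy with rfl | hy
      · exact absurd rfl hxy
      · rw [hammingDist_comm]; exact hz y hy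
      · exact hz x hx
      · exact hC.prop x hx y hy hxy
    have := hC.le_of_ge hzC (Finset.subset_insert z C) (Finset.mem_insert_self z C)
    simpa using hz z this
  have h := (Finset.card_le_card cover).trans Finset.card_biUnion_le
  have hcard : (Finset.univ : Finset (Cube n)).card = 2 ^ n := by
    simp [Cube, Finset.card_univ]
  rw [hcard] at h
  calc (2 : ℝ) ^ n ≤ ∑ y ∈ C,
        (((Finset.univ.filter fun x : Cube n => hammingDist y x ≤ m).card : ℕ) : ℝ) := by
        exact_mod_cast h
    _ ≤ ∑ y ∈ C, (Real.exp 1 * n ^ m) :=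
        Finset.sum_le_sum fun y _ => card_hammingBall_le hn m y
    _ = _ := by rw [Finset.sum_const, nsmul_eq_mul]

/-- The neighbour of `y` in direction `i`. -/
def flipAt (y : Cube n) (i : Fin n) : Cube n := Function.update y i (-y i)

theorem flipAt_apply_ne_iff (y : Cube n) (i k : Fin n) : y k ≠ flipAt y i k ↔ k = i := by
  unfold flipAt
  by_cases h : k = i
  · subst h
    simp only [Function.update_self, ne_eq, iff_true]
    exact units_ne_neg_self _
  · simp [h]

theorem hammingDist_flipAt (y : Cube n) (i : Fin n) : hammingDist y (flipAt y i) = 1 := by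
  refine Finset.card_eq_one.2 ⟨i, ?_⟩
  ext k
  rw [Finset.mem_filter, flipAt_apply_ne_iff, Finset.mem_singleton]
  simp

theorem flipAt_injective (y : Cube n) : Function.Injective (flipAt y) := by
  intro i k h
  have := (flipAt_apply_ne_iff y i i).2 rfl
  rw [h] at this
  exact (flipAt_apply_ne_iff y k i).1 this

theorem filter_hammingDist_eq_one (y : Cube n) :
    (Finset.univ.filter fun x => hammingDist y x = 1) = Finset.univ.image (flipAt y) := by
  ext x
  simp only [Finset.mem_filter, Finset.mem_univ, true_and, Finset.mem_image]
  constructor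
  · intro h
    obtain ⟨i, hi⟩ := Finset.card_eq_one.1 h
    refine ⟨i, ?_⟩
    ext1 k
    have hk : y k ≠ x k ↔ k = i := by
      simpa using congrArg (k ∈ ·) hi
    have hk' := flipAt_apply_ne_iff y i k
    rcases Int.units_eq_one_or (y k) with h1 | h1 <;>
      rcases Int.units_eq_one_or (x k) with h2 | h2 <;>
        rcases Int.units_eq_one_or (flipAt y i k) with h3 | h3 <;>
          rw [h1, h2] at hk <;> rw [h1, h3] at hk' <;> rw [h2, h3] <;> simp_all
  · rintro ⟨i, rfl⟩
    exact hammingDist_flipAt y i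

theorem sum_hammingDist_eq_one (y : Cube n) (g : Cube n → ℝ) :
    ∑ x with hammingDist y x = 1, g x = ∑ i, g (flipAt y i) := by
  rw [filter_hammingDist_eq_one, Finset.sum_image (flipAt_injective y).injOn]

end Cube

/-! ### Independence of events on disjoint coordinate sets -/

section Independence

variable {X B ι : Type*} [Fintype X] [DecidableEq X] [Fintype B]

open Classical in
/-- Events determined by complementary sets of coordinates are independent under the uniform
distribution. -/
theorem card_filter_and_mul_card (S : Set X) (P Q : (X → B) → Prop)
    (hP : ∀ f g : X → B, (∀ x ∈ S, f x = g x) → P f → P g)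
    (hQ : ∀ f g : X → B, (∀ x ∉ S, f x = g x) → Q f → Q g) :
    (Finset.univ.filter fun f => P f ∧ Q f).card * Fintype.card (X → B)
      = (Finset.univ.filter P).card * (Finset.univ.filter Q).card := by
  rw [← Finset.card_univ, ← Finset.card_product, ← Finset.card_product]
  have hl : ∀ (f g : X → B), ∀ x ∈ S, S.piecewise f g x = f x := fun f g x hx =>
    Set.piecewise_eq_of_mem _ _ _ hx
  have hr : ∀ (f g : X → B), ∀ x ∉ S, S.piecewise f g x = g x := fun f g x hx =>
    Set.piecewise_eq_of_notMem _ _ _ hx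
  have inv : ∀ f g : X → B, S.piecewise (S.piecewise f g) (S.piecewise g f) = f := by
    intro f g
    ext1 x
    by_cases hx : x ∈ S
    · rw [hl _ _ x hx, hl _ _ x hx]
    · rw [hr _ _ x hx, hr _ _ x hx]
  -- Exchanging the values of `f` and `g` off `S` is an involution on pairs.
  refine Finset.card_bij' (fun p _ => (S.piecewise p.1 p.2, S.piecewise p.2 p.1))
    (fun p _ => (S.piecewise p.1 p.2, S.piecewise p.2 p.1)) ?_ ?_ ?_ ?_
  · rintro ⟨f, g⟩ h
    simp only [Finset.mem_product, Finset.mem_filter, Finset.mem_univ, true_and, and_true] at h ⊢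
    exact ⟨hP f _ (fun x hx => (hl f g x hx).symm) h.1,
      hQ f _ (fun x hx => (hr g f x hx).symm) h.2⟩
  · rintro ⟨f, g⟩ h
    simp only [Finset.mem_product, Finset.mem_filter, Finset.mem_univ, true_and, and_true] at h ⊢
    exact ⟨hP f _ (fun x hx => (hl f g x hx).symm) h.1,
      hQ g _ (fun x hx => (hr f g x hx).symm) h.2⟩
  · rintro ⟨f, g⟩ _
    simp only [inv]
  · rintro ⟨f, g⟩ _
    simp only [inv]

open Classical in
/-- Avoiding events determined by pairwise disjoint sets of coordinates. -/
theorem card_filter_forall_le [Nonempty B] (C : Finset ι) (S : ι → Set X)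
    (P : ι → (X → B) → Prop) (hP : ∀ c, ∀ f g : X → B, (∀ x ∈ S c, f x = g x) → P c f → P c g)
    (hS : ∀ c ∈ C, ∀ d ∈ C, c ≠ d → Disjoint (S c) (S d)) (q : ℝ)
    (hq : ∀ c ∈ C, ((Finset.univ.filter (P c)).card : ℝ) ≤ q * Fintype.card (X → B)) :
    ((Finset.univ.filter fun f => ∀ c ∈ C, P c f).card : ℝ)
      ≤ q ^ C.card * Fintype.card (X → B) := by
  have hN : (0 : ℝ) < Fintype.card (X → B) := by exact_mod_cast Fintype.card_pos
  induction C using Finset.induction_on with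
  | empty => simp
  | insert c C hc ih =>
    have ih' := ih (fun a ha b hb => hS a (Finset.mem_insert_of_mem ha) b
      (Finset.mem_insert_of_mem hb)) (fun a ha => hq a (Finset.mem_insert_of_mem ha))
    have hqc := hq c (Finset.mem_insert_self c C)
    have key := card_filter_and_mul_card (S c) (P c) (fun f => ∀ a ∈ C, P a f) (hP c) (by
      intro f g hfg h a ha
      refine hP a f g (fun x hx => hfg x ?_) (h a ha)
      have := hS c (Finset.mem_insert_self c C) a (Finset.mem_insert_of_mem ha)
        (fun h => hc (h ▸ ha))
      exact fun hxc => Set.disjoint_left.1 this hxc hx)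
    have hset : (Finset.univ.filter fun f => ∀ a ∈ insert c C, P a f)
        = Finset.univ.filter fun f => P c f ∧ ∀ a ∈ C, P a f := by
      ext f
      simp
    rw [hset, Finset.card_insert_of_notMem hc, pow_succ]
    refine le_of_mul_le_mul_right ?_ hN
    have key' : ((Finset.univ.filter fun f => P c f ∧ ∀ a ∈ C, P a f).card : ℝ)
        * Fintype.card (X → B) = (Finset.univ.filter (P c)).card *
          (Finset.univ.filter fun f => ∀ a ∈ C, P a f).card := by
      norm_cast
      convert key
    rw [key']
    calc _ ≤ (q * Fintype.card (X → B)) * (q ^ C.card * Fintype.card (X → B)) := by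
          apply mul_le_mul hqc ih' (by positivity)
          -- No sign is assumed for `q`; the product is nonnegative because it dominates a
          -- cardinality.
          exact le_trans (by positivity) hqc
      _ = _ := by ring

end Independence

/-! ### The local failure event at a point -/

section LocalEvent

variable {n : ℕ}

/-- The signs of agreement of a Boolean function at `y` with its values at the neighbours. -/
def agreeHom (y : Cube n) : BoolFun n →* Cube n where
  toFun f i := f y * f (flipAt y i)
  map_one' := by ext; simp
  map_mul' f g := by
    funext i
    simp only [Pi.mul_apply]
    exact mul_mul_mul_comm _ _ _ _

theorem agreeHom_apply (y : Cube n) (f : BoolFun n) (i : Fin n) :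
    agreeHom y f i = f y * f (flipAt y i) := rfl

theorem agreeHom_surjective (y : Cube n) : Function.Surjective (agreeHom y) := by
  intro v
  refine ⟨Function.extend (flipAt y) v 1, ?_⟩
  funext i
  rw [agreeHom_apply, (flipAt_injective y).extend_apply, Function.extend_apply', Pi.one_apply,
    one_mul]
  rintro ⟨k, hk⟩
  have := hammingDist_flipAt y k
  rw [hk, hammingDist_self] at this
  exact zero_ne_one this

/-- The fibres of a surjective group homomorphism have equal size, so the agreement pattern of a
uniform `f` is uniform on the cube. -/
theorem card_agreeHom_fiber (y : Cube n) (v : Cube n) :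
    (Finset.univ.filter fun f => agreeHom y f = v).card * 2 ^ n = Fintype.card (BoolFun n) := by
  have h := Finset.card_eq_sum_card_fiberwise (f := agreeHom y) (s := Finset.univ)
    (t := Finset.univ) (fun _ _ => Finset.mem_coe.2 (Finset.mem_univ _))
  rw [Finset.sum_congr rfl fun w _ => MonoidHom.card_fiber_eq_of_mem_range (agreeHom y)
    (agreeHom_surjective y w) (agreeHom_surjective y v), Finset.sum_const, Finset.card_univ] at h
  rw [h, smul_eq_mul, mul_comm]
  congr 1
  simp [Cube]

theorem card_filter_card_eq_one_eq_choose (n j : ℕ) :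
    (Finset.univ.filter fun v : Cube n => (Finset.univ.filter fun i => v i = 1).card = j).card
      = n.choose j := by
  have h : n.choose j = (Finset.powersetCard j (Finset.univ : Finset (Fin n))).card := by
    simp
  rw [h]
  refine Finset.card_bij' (fun v _ => Finset.univ.filter fun i => v i = 1)
    (fun s _ i => if i ∈ s then 1 else -1) ?_ ?_ ?_ ?_
  · intro v hv
    simpa [Finset.mem_powersetCard] using hv
  · intro s hs
    rw [Finset.mem_powersetCard] at hs
    rw [Finset.mem_filter]
    refine ⟨Finset.mem_univ _, ?_⟩
    convert hs.2 using 2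
    ext i
    by_cases hi : i ∈ s <;> simp [hi]
  · intro v _
    funext i
    rcases Int.units_eq_one_or (v i) with h | h <;> simp [h]
  · intro s _
    ext i
    by_cases hi : i ∈ s <;> simp [hi]

/-- The number of Boolean functions that agree at `y` with exactly `j` of the neighbours. -/
theorem card_agree_eq (y : Cube n) (j : ℕ) :
    (Finset.univ.filter fun f : BoolFun n =>
      (Finset.univ.filter fun i => agreeHom y f i = 1).card = j).card * 2 ^ n
      = n.choose j * Fintype.card (BoolFun n) := by
  rw [Finset.card_eq_sum_card_fiberwise (f := agreeHom y)
    (t := Finset.univ.filter fun v : Cube n => (Finset.univ.filter fun i => v i = 1).card = j)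
    (by intro f hf; simpa using hf), Finset.sum_mul,
    ← card_filter_card_eq_one_eq_choose, ← smul_eq_mul, ← Finset.sum_const]
  refine Finset.sum_congr rfl fun v hv => ?_
  rw [← card_agreeHom_fiber y v]
  congr 2
  ext f
  simp only [Finset.mem_filter, Finset.mem_univ, true_and] at hv ⊢
  constructor
  · exact fun h => h.2
  · intro h
    rw [h]
    exact ⟨hv, rfl⟩

theorem sum_units_eq (v : Cube n) :
    ∑ i, ((v i : ℤ) : ℝ) = 2 * (Finset.univ.filter fun i => v i = 1).card - n := by
  have h : ∀ i, ((v i : ℤ) : ℝ) = 2 * (if v i = 1 then 1 else 0) - 1 := by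
    intro i
    rcases Int.units_eq_one_or (v i) with h | h <;> rw [h] <;> norm_num
  rw [Finset.sum_congr rfl fun i _ => h i, Finset.sum_sub_distrib, ← Finset.mul_sum,
    Finset.sum_boole]
  simp

theorem unit_mul_self_cast (u : ℤˣ) : ((u : ℤ) : ℝ) * ((u : ℤ) : ℝ) = 1 := by
  rcases Int.units_eq_one_or u with h | h <;> rw [h] <;> norm_num

theorem abs_unit_cast (u : ℤˣ) : |((u : ℤ) : ℝ)| = 1 := by
  rcases Int.units_eq_one_or u with h | h <;> rw [h] <;> norm_num

/-- The part of `f y * T_ρ f y` coming from the points at distance in `[2, K]`. -/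
noncomputable def middlePart (ρ : ℝ) (K : ℕ) (y : Cube n) (f : BoolFun n) : ℝ :=
  ((f y : ℤ) : ℝ) *
    ∑ x with 2 ≤ hammingDist y x ∧ hammingDist y x ≤ K, condPmf ρ x y * ((f x : ℤ) : ℝ)

/-- The part of `f y * T_ρ f y` coming from the points at distance at most `K`. -/
noncomputable def localPart (ρ : ℝ) (K : ℕ) (y : Cube n) (f : BoolFun n) : ℝ :=
  ((f y : ℤ) : ℝ) * ∑ x with hammingDist y x ≤ K, condPmf ρ x y * ((f x : ℤ) : ℝ)

theorem localPart_congr (ρ : ℝ) (K : ℕ) (y : Cube n) (f g : BoolFun n)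
    (h : ∀ x, hammingDist y x ≤ K → f x = g x) : localPart ρ K y f = localPart ρ K y g := by
  unfold localPart
  rw [h y (by simp)]
  congr 1
  refine Finset.sum_congr rfl fun x hx => ?_
  rw [h x (Finset.mem_filter.1 hx).2]

/-- Negation of the values of `f` at the points at distance at least two from `y`. -/
def negFar (y : Cube n) (f : BoolFun n) : BoolFun n :=
  fun x => if 2 ≤ hammingDist y x then -f x else f x

theorem negFar_negFar (y : Cube n) (f : BoolFun n) : negFar y (negFar y f) = f := by
  funext x
  unfold negFar
  by_cases h : 2 ≤ hammingDist y x <;> simp [h]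

theorem negFar_self (y : Cube n) (f : BoolFun n) : negFar y f y = f y := by
  simp [negFar]

theorem agreeHom_negFar (y : Cube n) (f : BoolFun n) : agreeHom y (negFar y f) = agreeHom y f := by
  funext i
  rw [agreeHom_apply, agreeHom_apply, negFar_self]
  simp [negFar, hammingDist_flipAt]

theorem middlePart_negFar (ρ : ℝ) (K : ℕ) (y : Cube n) (f : BoolFun n) :
    middlePart ρ K y (negFar y f) = -middlePart ρ K y f := by
  unfold middlePart
  rw [negFar_self, ← mul_neg, ← Finset.sum_neg_distrib]
  congr 1
  refine Finset.sum_congr rfl fun x hx => ?_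
  have := (Finset.mem_filter.1 hx).2.1
  simp [negFar, this]

/-- By symmetry, the contribution of the points at distance at least two is nonpositive for at
least half of the functions with a given number of agreeing neighbours. -/
theorem card_agree_le_two_mul (ρ : ℝ) (K : ℕ) (y : Cube n) (j : ℕ) :
    (Finset.univ.filter fun f : BoolFun n =>
      (Finset.univ.filter fun i => agreeHom y f i = 1).card = j).card
      ≤ 2 * (Finset.univ.filter fun f : BoolFun n =>
        (Finset.univ.filter fun i => agreeHom y f i = 1).card = j ∧
          middlePart ρ K y f ≤ 0).card := by
  classical
  rw [← Finset.card_filter_add_card_filter_not (fun f => middlePart ρ K y f ≤ 0),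
    Finset.filter_filter, Finset.filter_filter, two_mul]
  -- `negFar y` keeps the agreement count and reverses the sign of the middle part, so it injects
  -- the positive case into the nonpositive one.
  refine Nat.add_le_add_left (Finset.card_le_card_of_injOn (negFar y) ?_ ?_) _
  · intro f hf
    simp only [Finset.coe_filter, Finset.mem_univ, true_and, Set.mem_ofPred_eq, not_le] at hf ⊢
    rw [agreeHom_negFar, middlePart_negFar]
    exact ⟨hf.1, by linarith [hf.2]⟩
  · intro f _ g _ h
    rw [← negFar_negFar y f, h, negFar_negFar]

theorem localPart_eq (ρ : ℝ) {K : ℕ} (hK : 1 ≤ K) (y : Cube n) (f : BoolFun n) :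
    localPart ρ K y f = (1 - (1 - ρ) / 2) ^ n
      + (1 - (1 - ρ) / 2) ^ (n - 1) * ((1 - ρ) / 2) *
        (2 * (Finset.univ.filter fun i => agreeHom y f i = 1).card - n)
      + middlePart ρ K y f := by
  have hsplit : (Finset.univ.filter fun x => hammingDist y x ≤ K) =
      insert y ((Finset.univ.filter fun x => hammingDist y x = 1) ∪
        (Finset.univ.filter fun x => 2 ≤ hammingDist y x ∧ hammingDist y x ≤ K)) := by
    ext x
    simp only [Finset.mem_filter, Finset.mem_univ, true_and, Finset.mem_insert, Finset.mem_union]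
    have h0 : x = y ↔ hammingDist y x = 0 := by rw [hammingDist_eq_zero]; exact eq_comm
    rw [h0]
    omega
  have hdisj : Disjoint (Finset.univ.filter fun x => hammingDist y x = 1)
        (Finset.univ.filter fun x => 2 ≤ hammingDist y x ∧ hammingDist y x ≤ K) := by
    rw [Finset.disjoint_filter]
    intro x _ h1 h2
    omega
  have hy : y ∉ (Finset.univ.filter fun x => hammingDist y x = 1) ∪
        (Finset.univ.filter fun x => 2 ≤ hammingDist y x ∧ hammingDist y x ≤ K) := by
    simp
  unfold localPart middlePart
  rw [hsplit, Finset.sum_insert hy, Finset.sum_union hdisj, sum_hammingDist_eq_one, mul_add,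
    mul_add, ← add_assoc]
  congr 2
  · rw [condPmf_eq, hammingDist_self, mul_left_comm, unit_mul_self_cast]
    simp
  · rw [← sum_units_eq, Finset.mul_sum, Finset.mul_sum]
    refine Finset.sum_congr rfl fun i _ => ?_
    rw [condPmf_eq, hammingDist_flipAt, agreeHom_apply]
    push_cast
    ring

/-- If the local part is sufficiently negative, then `f` fails to predict itself at `y`. -/
theorem not_isSPAt_of_localPart_lt {ρ : ℝ} (h0 : 0 ≤ ρ) (h1 : ρ ≤ 1) (K : ℕ) (y : Cube n)
    (f : BoolFun n) (h : localPart ρ K y f < -(Real.exp (n * ((1 - ρ) / 2)) / 2 ^ K)) :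
    ¬ IsSPAt ρ f y := by
  have hsum : ((f y : ℤ) : ℝ) * noiseOp ρ f y = localPart ρ K y f +
      ((f y : ℤ) : ℝ) * ∑ x with ¬ hammingDist y x ≤ K, condPmf ρ x y * ((f x : ℤ) : ℝ) := by
    unfold localPart noiseOp
    rw [← mul_add, Finset.sum_filter_add_sum_filter_not]
  have htail : ((f y : ℤ) : ℝ) * ∑ x with ¬ hammingDist y x ≤ K, condPmf ρ x y * ((f x : ℤ) : ℝ)
      ≤ Real.exp (n * ((1 - ρ) / 2)) / 2 ^ K := by
    refine (le_abs_self _).trans ?_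
    rw [abs_mul, abs_unit_cast, one_mul]
    refine (Finset.abs_sum_le_sum_abs _ _).trans (le_trans (le_of_eq ?_)
      (sum_condPmf_far_le h0 h1 K y))
    refine Finset.sum_congr rfl fun x _ => ?_
    rw [abs_mul, abs_unit_cast, mul_one, abs_of_nonneg (condPmf_nonneg h0 h1 x y)]
  have hneg : ((f y : ℤ) : ℝ) * noiseOp ρ f y < 0 := by linarith
  intro hsp
  have hne : noiseOp ρ f y ≠ 0 := by
    intro h
    rw [h, mul_zero] at hneg
    exact lt_irrefl _ hneg
  rw [hsp hne] at hneg
  rcases lt_or_gt_of_ne hne with h | h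
  · rw [Real.sign_of_neg h] at hneg
    linarith
  · rw [Real.sign_of_pos h] at hneg
    linarith

end LocalEvent

/-! ### Stirling bounds and the entropy exponent -/

section Entropy

theorem le_log_factorial (n : ℕ) : n * Real.log n - n ≤ Real.log (n.factorial) := by
  rcases Nat.eq_zero_or_pos n with rfl | hn
  · simp
  have hn' : (0 : ℝ) < n := by exact_mod_cast hn
  have h := Real.pow_div_factorial_le_exp (n : ℝ) hn'.le n
  have hf : (0 : ℝ) < n.factorial := by exact_mod_cast n.factorial_pos
  have h2 := Real.log_le_log (by positivity) h
  rw [Real.log_exp, Real.log_div (by positivity) hf.ne', Real.log_pow] at h2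
  linarith

/-- The Stirling sequence decreases from its value `e / √2` at 1. -/
theorem log_factorial_le (n : ℕ) :
    Real.log (n.factorial) ≤ n * Real.log n - n + Real.log n / 2 + 1 := by
  rcases Nat.eq_zero_or_pos n with rfl | hn
  · simp
  obtain ⟨m, rfl⟩ : ∃ m, n = m + 1 := ⟨n - 1, by omega⟩
  have h := Stirling.log_stirlingSeq'_antitone (Nat.zero_le m)
  simp only [Function.comp, Nat.succ_eq_add_one, zero_add] at h
  have hn' : (0 : ℝ) < ((m + 1 : ℕ) : ℝ) := by positivity
  rw [Stirling.log_stirlingSeq_formula, Stirling.stirlingSeq_one,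
    Real.log_div (Real.exp_pos 1).ne' (by positivity), Real.log_exp,
    Real.log_sqrt (by norm_num), Real.log_mul (by norm_num) hn'.ne',
    Real.log_div hn'.ne' (Real.exp_pos 1).ne', Real.log_exp] at h
  linarith

/-- The entropy lower bound for binomial coefficients. -/
theorem mul_binEntropy_le_log_choose {n j : ℕ} (hn : 0 < n) (hj : j ≤ n) :
    n * Real.binEntropy (j / n) - Real.log n - 2 ≤ Real.log (n.choose j) := by
  have hn' : (0 : ℝ) < n := by exact_mod_cast hn
  have hpos : ∀ k : ℕ, ((k.factorial : ℕ) : ℝ) ≠ 0 := fun k => by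
    exact_mod_cast k.factorial_ne_zero
  have hc : ((n.choose j : ℕ) : ℝ) ≠ 0 := by exact_mod_cast (Nat.choose_pos hj).ne'
  have hfac := congrArg (fun k : ℕ => Real.log (k : ℝ)) (Nat.choose_mul_factorial_mul_factorial hj)
  simp only [Nat.cast_mul] at hfac
  rw [Real.log_mul (mul_ne_zero hc (hpos _)) (hpos _), Real.log_mul hc (hpos _)] at hfac
  have h1 := le_log_factorial n
  have h2 := log_factorial_le j
  have h3 := log_factorial_le (n - j)
  have hlog : ∀ k : ℕ, k ≤ n → Real.log k ≤ Real.log n := by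
    intro k hk
    rcases Nat.eq_zero_or_pos k with rfl | hk0
    · simp [Real.log_nonneg (by exact_mod_cast hn : (1 : ℝ) ≤ n)]
    · exact Real.log_le_log (by exact_mod_cast hk0) (by exact_mod_cast hk)
  have h4 := hlog j hj
  have h5 := hlog (n - j) (Nat.sub_le n j)
  have hneg : ∀ k : ℕ, (n : ℝ) * Real.negMulLog (k / n) = k * Real.log n - k * Real.log k := by
    intro k
    rcases Nat.eq_zero_or_pos k with rfl | hk
    · simp
    · have hk' : (0 : ℝ) < k := by exact_mod_cast hk
      rw [Real.negMulLog, Real.log_div hk'.ne' hn'.ne']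
      field_simp
      ring
  have hsub : (1 : ℝ) - j / n = ((n - j : ℕ) : ℝ) / n := by
    rw [Nat.cast_sub hj]
    field_simp
  rw [Real.binEntropy_eq_negMulLog_add_negMulLog_one_sub, hsub, mul_add, hneg, hneg]
  have hcast : ((n - j : ℕ) : ℝ) = n - j := Nat.cast_sub hj
  rw [hcast] at h3 h5 ⊢
  linarith

theorem binEnt_eq (t : ℝ) : binEnt t = Real.binEntropy t / Real.log 2 := by
  rw [binEnt, Real.binEntropy_eq_negMulLog_add_negMulLog_one_sub, Real.negMulLog, Real.negMulLog,
    Real.logb, Real.logb]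
  ring

theorem eventually_rpow_le_choose_floor {t h : ℝ} (ht0 : 0 ≤ t) (ht1 : t ≤ 1)
    (hlt : h < binEnt t) {c : ℝ} (hc : 0 < c) (m : ℕ) :
    ∀ᶠ n : ℕ in atTop, (2 : ℝ) ^ ((n : ℝ) * h) ≤ (n.choose ⌊t * n⌋₊ : ℝ) / (c * n ^ m) := by
  have hl2 : 0 < Real.log 2 := Real.log_pos (by norm_num)
  have hlt' : h * Real.log 2 < Real.binEntropy t := by
    rwa [binEnt_eq, lt_div_iff₀ hl2] at hlt
  have hent : Tendsto (fun n : ℕ => Real.binEntropy ((⌊t * n⌋₊ : ℝ) / n)) atTop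
      (nhds (Real.binEntropy t)) :=
    (Real.binEntropy_continuous.tendsto t).comp
      ((tendsto_nat_floor_mul_div_atTop ht0).comp tendsto_natCast_atTop_atTop)
  have hlog : Tendsto (fun n : ℕ => Real.log n / n) atTop (nhds 0) :=
    (Real.isLittleO_log_id_atTop.tendsto_div_nhds_zero).comp tendsto_natCast_atTop_atTop
  have hinv : Tendsto (fun n : ℕ => (2 + Real.log c) / n) atTop (nhds 0) :=
    tendsto_const_div_atTop_nhds_zero_nat _
  have hlim : Tendsto (fun n : ℕ => Real.binEntropy ((⌊t * n⌋₊ : ℝ) / n)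
      - (m + 1) * (Real.log n / n) - (2 + Real.log c) / n) atTop
      (nhds (Real.binEntropy t - (m + 1) * 0 - 0)) :=
    (hent.sub (hlog.const_mul _)).sub hinv
  rw [mul_zero, sub_zero, sub_zero] at hlim
  filter_upwards [hlim.eventually_const_lt hlt', eventually_gt_atTop 0] with n hn hn0
  have hn' : (0 : ℝ) < n := by exact_mod_cast hn0
  have hj : ⌊t * n⌋₊ ≤ n := by
    refine Nat.floor_le_of_le ?_
    nlinarith
  have hch : (0 : ℝ) < n.choose ⌊t * n⌋₊ := by exact_mod_cast Nat.choose_pos hj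
  have key := mul_binEntropy_le_log_choose hn0 hj
  have hmul := mul_lt_mul_of_pos_left hn hn'
  have hexp : (n : ℝ) * (Real.binEntropy ((⌊t * n⌋₊ : ℝ) / n)
      - (m + 1) * (Real.log n / n) - (2 + Real.log c) / n) =
      n * Real.binEntropy ((⌊t * n⌋₊ : ℝ) / n) - (m + 1) * Real.log n - (2 + Real.log c) := by
    field_simp
  rw [hexp] at hmul
  rw [← Real.log_le_log_iff (by positivity) (by positivity), Real.log_rpow (by norm_num),
    Real.log_div hch.ne' (by positivity), Real.log_mul hc.ne' (by positivity), Real.log_pow]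
  linarith

end Entropy

/-! ### From an `ε`-loss in the exponent to one `o(n)` term -/

section ErrorTerm

theorem exists_isLittleO_exponent (F : ℕ → ℝ) (h : ℝ) (P : ℕ → Prop) (hF : ∀ n, P n → F n < 1)
    (hP : ∀ᶠ n in atTop, P n)
    (hε : ∀ ε > 0, ∀ᶠ n : ℕ in atTop, F n ≤ Real.exp (-(2 : ℝ) ^ ((n : ℝ) * (h - ε)))) :
    ∃ r : ℕ → ℝ, r =o[atTop] (fun n : ℕ => (n : ℝ)) ∧
      ∀ n : ℕ, P n → F n ≤ Real.exp (-(2 : ℝ) ^ ((n : ℝ) * h + r n)) := by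
  -- The maximum keeps the logarithm meaningful if `F n = 0` and forces `r n ≤ 0` wherever `P n`
  -- holds, so only the lower bound on `r` needs `hε`.
  set G : ℕ → ℝ := fun n => max (F n) (Real.exp (-(2 : ℝ) ^ ((n : ℝ) * h))) with hG
  have hGpos : ∀ n, 0 < G n := fun n => lt_max_of_lt_right (Real.exp_pos _)
  have hGlog : ∀ n, P n → 0 < -Real.log (G n) := by
    intro n hn
    have h1 : G n < 1 := max_lt (hF n hn) (by
      rw [← Real.exp_zero]
      exact Real.exp_lt_exp.2 (neg_lt_zero.2 (by positivity)))
    linarith [Real.log_neg (hGpos n) h1]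
  have hpow : ∀ n, P n →
      (2 : ℝ) ^ ((n : ℝ) * h + (Real.logb 2 (-Real.log (G n)) - n * h)) = -Real.log (G n) := by
    intro n hn
    rw [add_sub_cancel, Real.rpow_logb (by norm_num) (by norm_num) (hGlog n hn)]
  refine ⟨fun n => Real.logb 2 (-Real.log (G n)) - n * h, ?_, ?_⟩
  · rw [isLittleO_iff]
    intro ε hε0
    filter_upwards [hε ε hε0, hP] with n hn hPn
    have hlog := hGlog n hPn
    have hup : Real.logb 2 (-Real.log (G n)) ≤ n * h := by
      rw [Real.logb_le_iff_le_rpow (by norm_num) hlog]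
      have := Real.log_le_log (Real.exp_pos _) (le_max_right (F n) _ :
        Real.exp (-(2 : ℝ) ^ ((n : ℝ) * h)) ≤ G n)
      rw [Real.log_exp] at this
      linarith
    have hlow : n * (h - ε) ≤ Real.logb 2 (-Real.log (G n)) := by
      rw [Real.le_logb_iff_rpow_le (by norm_num) hlog]
      have hle : G n ≤ Real.exp (-(2 : ℝ) ^ ((n : ℝ) * (h - ε))) := by
        refine max_le hn (Real.exp_le_exp.2 (neg_le_neg ?_))
        refine Real.rpow_le_rpow_of_exponent_le (by norm_num) ?_
        exact mul_le_mul_of_nonneg_left (by linarith) (Nat.cast_nonneg n)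
      have := Real.log_le_log (hGpos n) hle
      rw [Real.log_exp] at this
      linarith
    rw [Real.norm_eq_abs, Real.norm_of_nonneg (Nat.cast_nonneg n), abs_le]
    constructor <;> linarith
  · intro n hn
    rw [hpow n hn, neg_neg, Real.exp_log (hGpos n)]
    exact le_max_left _ _

end ErrorTerm

/-! ### Bounding the fraction of self-predicting functions -/

section Fraction

variable {n : ℕ}

theorem exp_neg_two_mul_le_pow {δ : ℝ} (h0 : 0 ≤ δ) (h1 : δ ≤ 1 / 2) (n : ℕ) :
    Real.exp (-(2 * (n * δ))) ≤ (1 - δ) ^ n := by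
  have h : Real.exp (-(2 * δ)) ≤ 1 - δ := by
    have h2 := Real.add_one_le_exp (2 * δ)
    rw [Real.exp_neg]
    refine inv_le_of_inv_le₀ (by linarith) (le_trans ?_ h2)
    rw [inv_le_iff_one_le_mul₀ (by linarith)]
    nlinarith
  calc Real.exp (-(2 * (n * δ))) = Real.exp (-(2 * δ)) ^ n := by
        rw [← Real.exp_nat_mul]
        ring_nf
    _ ≤ (1 - δ) ^ n := by gcongr

theorem localPart_lt {α η : ℝ} (hα : 0 < α) (hn : 2 * α ≤ n) (hη : 0 < η) {K : ℕ} (hK : 1 ≤ K)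
    (hKη : Real.exp α / 2 ^ K < η * Real.exp (-(2 * α))) (y : Cube n) (f : BoolFun n)
    (hj : 2 * α * (Finset.univ.filter fun i => agreeHom y f i = 1).card ≤ n * (α - 1 - η))
    (hmid : middlePart (1 - 2 * α / n) K y f ≤ 0) :
    localPart (1 - 2 * α / n) K y f < -(Real.exp α / 2 ^ K) := by
  set j := (Finset.univ.filter fun i => agreeHom y f i = 1).card
  have hn' : (0 : ℝ) < n := by linarith
  have hnpos : 0 < n := by exact_mod_cast hn'
  have hδ : (1 - (1 - 2 * α / (n : ℝ))) / 2 = α / n := by ring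
  rw [localPart_eq _ hK, hδ]
  have hδ0 : 0 ≤ α / n := by positivity
  have hδ1 : α / n ≤ 1 / 2 := by
    rw [div_le_div_iff₀ hn' (by norm_num)]
    linarith
  have hW := exp_neg_two_mul_le_pow hδ0 hδ1 n
  rw [mul_div_cancel₀ _ hn'.ne'] at hW
  have hpow : (1 - α / n) ^ n ≤ (1 - α / n) ^ (n - 1) :=
    pow_le_pow_of_le_one (by linarith) (by linarith) (Nat.sub_le n 1)
  -- The `-1` cancels the contribution of the centre; the surplus `-η` has to beat the tail.
  have hs : α / n * (2 * j - n) ≤ -1 - η := by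
    rw [div_mul_eq_mul_div, div_le_iff₀ hn']
    linarith
  have h1 : (1 - α / n) ^ (n - 1) * (α / n) * (2 * j - n) ≤ (1 - α / n) ^ n * (-1 - η) := by
    rw [mul_assoc]
    calc (1 - α / n) ^ (n - 1) * (α / n * (2 * j - n))
        ≤ (1 - α / n) ^ n * (α / n * (2 * j - n)) :=
          mul_le_mul_of_nonpos_right hpow (by linarith)
      _ ≤ _ := mul_le_mul_of_nonneg_left hs (pow_nonneg (by linarith) n)
  have h2 : η * Real.exp (-(2 * α)) ≤ η * (1 - α / n) ^ n :=
    mul_le_mul_of_nonneg_left hW hη.le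
  linarith

-- In probabilistic terms, the local failure event has probability at least `n.choose j / 2 ^ (n +
-- 1)`; the extra factor 2 pays for the sign of the middle part.
open Classical in
theorem choose_mul_card_le_card_localPart_lt {α η : ℝ} (hα : 0 < α) (hn : 2 * α ≤ n) (hη : 0 < η)
    {K : ℕ} (hK : 1 ≤ K) (hKη : Real.exp α / 2 ^ K < η * Real.exp (-(2 * α))) {j : ℕ}
    (hj : 2 * α * j ≤ n * (α - 1 - η)) (y : Cube n) :
    n.choose j * Fintype.card (BoolFun n) ≤ 2 ^ n * (2 * (Finset.univ.filter fun f : BoolFun n =>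
      localPart (1 - 2 * α / n) K y f < -(Real.exp α / 2 ^ K)).card) := by
  rw [← card_agree_eq y j, mul_comm]
  refine Nat.mul_le_mul_left _ ((card_agree_le_two_mul (1 - 2 * α / n) K y j).trans ?_)
  refine Nat.mul_le_mul_left _ (Finset.card_le_card fun f hf => ?_)
  simp only [Finset.mem_filter, Finset.mem_univ, true_and] at hf ⊢
  exact localPart_lt hα hn hη hK hKη y f (by rw [hf.1]; exact hj) hf.2

/-- A nonasymptotic bound on the fraction of self-predicting functions. -/
theorem fractionSP_le {α η : ℝ} (hα : 0 < α) (hn : 2 * α ≤ n) (hη : 0 < η) {K : ℕ} (hK : 1 ≤ K)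
    (hKη : Real.exp α / 2 ^ K < η * Real.exp (-(2 * α))) {j : ℕ}
    (hj : 2 * α * j ≤ n * (α - 1 - η)) :
    fractionSP n (1 - 2 * α / n) ≤
      Real.exp (-((n.choose j : ℝ) / (2 * Real.exp 1 * n ^ (2 * K)))) := by
  classical
  have hn' : (0 : ℝ) < n := by linarith
  have hnpos : 0 < n := by exact_mod_cast hn'
  set ρ : ℝ := 1 - 2 * α / n with hρ
  have hρ0 : 0 ≤ ρ := by
    have := (div_le_one hn').2 hn
    rw [hρ]; linarith
  have hρ1 : ρ ≤ 1 := by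
    have : 0 ≤ 2 * α / n := by positivity
    rw [hρ]; linarith
  have hexp : (n : ℝ) * ((1 - ρ) / 2) = α := by
    rw [hρ]; field_simp; ring
  set N : ℝ := (Fintype.card (BoolFun n) : ℝ) with hN
  have hNpos : 0 < N := by rw [hN]; exact_mod_cast Fintype.card_pos
  -- Distance greater than `2 * K` makes the balls of radius `K` disjoint.
  obtain ⟨C, hC, hcard⟩ := exists_code hnpos (2 * K)
  set q : ℝ := (n.choose j : ℝ) / (2 ^ n * 2) with hq
  let Good : Cube n → BoolFun n → Prop := fun y f =>
    ¬ localPart ρ K y f < -(Real.exp α / 2 ^ K)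
  have hgood : ∀ y ∈ C, ((Finset.univ.filter (Good y)).card : ℝ) ≤ (1 - q) * N := by
    intro y _
    have h1 := choose_mul_card_le_card_localPart_lt hα hn hη hK hKη hj y
    have h2 := Finset.card_filter_add_card_filter_not (s := Finset.univ)
      (fun f : BoolFun n => localPart ρ K y f < -(Real.exp α / 2 ^ K))
    rw [Finset.card_univ] at h2
    have h1' : (n.choose j : ℝ) * N ≤ 2 ^ n * (2 * ((Finset.univ.filter fun f : BoolFun n =>
      localPart ρ K y f < -(Real.exp α / 2 ^ K)).card : ℝ)) := by
      rw [hN]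
      exact_mod_cast h1
    have h2' : ((Finset.univ.filter fun f : BoolFun n =>
      localPart ρ K y f < -(Real.exp α / 2 ^ K)).card : ℝ) +
        ((Finset.univ.filter (Good y)).card : ℝ) = N := by
      rw [hN, ← h2]
      push_cast
      rfl
    have h3 : q * N ≤ ((Finset.univ.filter fun f : BoolFun n =>
      localPart ρ K y f < -(Real.exp α / 2 ^ K)).card : ℝ) := by
      rw [hq, div_mul_eq_mul_div, div_le_iff₀ (by positivity)]
      linarith
    linarith
  have hall := card_filter_forall_le C (fun y => {x | hammingDist y x ≤ K}) Good
    (fun y f g hfg => by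
      simp only [Good, localPart_congr ρ K y f g hfg, imp_self])
    (by
      intro x hx y hy hxy
      rw [Set.disjoint_left]
      intro z (hz : hammingDist x z ≤ K) (hz' : hammingDist y z ≤ K)
      have := hC x hx y hy hxy
      have := hammingDist_triangle_right x y z
      omega) (1 - q) (fun y hy => by convert hgood y hy)
  have hSP : (Nat.card {f : BoolFun n // IsSP ρ f} : ℝ) ≤
      ((Finset.univ.filter fun f => ∀ y ∈ C, Good y f).card : ℝ) := by
    rw [Nat.card_eq_fintype_card, Fintype.card_subtype]
    refine Nat.cast_le.2 (Finset.card_le_card fun f hf => ?_)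
    simp only [Finset.mem_filter, Finset.mem_univ, true_and] at hf ⊢
    intro y _ hlt
    refine not_isSPAt_of_localPart_lt hρ0 hρ1 K y f ?_ (hf y)
    rwa [hexp]
  have hq1 : q ≤ 1 := by
    rw [hq, div_le_one (by positivity)]
    have : (n.choose j : ℝ) ≤ 2 ^ n := by exact_mod_cast Nat.choose_le_two_pow n j
    have : (0 : ℝ) < 2 ^ n := by positivity
    linarith
  have hfrac : fractionSP n ρ ≤ (1 - q) ^ C.card := by
    rw [fractionSP, Nat.card_eq_fintype_card (α := BoolFun n), div_le_iff₀ hNpos]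
    refine hSP.trans (le_of_eq_of_le ?_ hall)
    congr!
  refine hfrac.trans ?_
  calc (1 - q) ^ C.card ≤ Real.exp (-q) ^ C.card := by
        have := Real.one_sub_le_exp_neg q
        gcongr
    _ = Real.exp (-(C.card * q)) := by
        rw [← Real.exp_nat_mul]
        ring_nf
    _ ≤ _ := by
        refine Real.exp_le_exp.2 (neg_le_neg ?_)
        rw [hq, mul_div_assoc', div_le_div_iff₀ (by positivity) (by positivity)]
        calc (n.choose j : ℝ) * (2 ^ n * 2)
            ≤ n.choose j * ((C.card * (Real.exp 1 * n ^ (2 * K))) * 2) := by gcongr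
          _ = _ := by ring

theorem exists_radius (α : ℝ) {η : ℝ} (hη : 0 < η) :
    ∃ K : ℕ, 1 ≤ K ∧ Real.exp α / 2 ^ K < η * Real.exp (-(2 * α)) := by
  have h : Tendsto (fun K : ℕ => Real.exp α / (2 : ℝ) ^ K) atTop (nhds 0) :=
    tendsto_const_nhds.div_atTop (tendsto_pow_atTop_atTop_of_one_lt (by norm_num))
  obtain ⟨K, hK1, hK2⟩ := ((eventually_ge_atTop 1).and
    (h.eventually_lt_const (by positivity : 0 < η * Real.exp (-(2 * α))))).exists
  exact ⟨K, hK1, hK2⟩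

/-- Taking `j = 0` and `η = α - 1` gives a strict bound for every admissible `n`, which makes the
error term definable outside the asymptotic range as well. -/
theorem fractionSP_lt_one {α : ℝ} (hα : 1 < α) (hn : 2 * α ≤ n) :
    fractionSP n (1 - 2 * α / n) < 1 := by
  obtain ⟨K, hK, hKη⟩ := exists_radius α (sub_pos.2 hα)
  refine (fractionSP_le (j := 0) (by linarith) hn (sub_pos.2 hα) hK hKη (by simp)).trans_lt ?_
  have hn' : (0 : ℝ) < n := by linarith
  rw [← Real.exp_zero]
  refine Real.exp_lt_exp.2 (neg_lt_zero.2 ?_)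
  rw [Nat.choose_zero_right]
  positivity

theorem eventually_fractionSP_le {α : ℝ} (hα : 1 < α) {ε : ℝ} (hε : 0 < ε) :
    ∀ᶠ n : ℕ in atTop, fractionSP n (1 - 2 * α / n) ≤
      Real.exp (-(2 : ℝ) ^ ((n : ℝ) * (binEnt ((α - 1) / (2 * α)) - ε))) := by
  have hcont : Continuous fun η : ℝ => binEnt ((α - 1 - η) / (2 * α)) := by
    simp_rw [binEnt_eq]
    fun_prop
  have hnear : ∀ᶠ η in nhdsWithin (0 : ℝ) (Set.Ioi 0),
      binEnt ((α - 1) / (2 * α)) - ε < binEnt ((α - 1 - η) / (2 * α)) := by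
    have h := (hcont.tendsto 0).eventually_const_lt
      (u := binEnt ((α - 1) / (2 * α)) - ε) (by rw [sub_zero]; linarith)
    exact h.filter_mono nhdsWithin_le_nhds
  -- Continuity of the entropy allows a small `η > 0` costing less than `ε`; `η < α - 1` keeps the
  -- proportion of agreeing neighbours positive.
  obtain ⟨η, hη, hη0, hη1⟩ := (hnear.and (Ioo_mem_nhdsGT (sub_pos.2 hα))).exists
  obtain ⟨K, hK, hKη⟩ := exists_radius α hη0
  have hα0 : 0 < 2 * α := by linarith
  have ht0 : 0 ≤ (α - 1 - η) / (2 * α) := div_nonneg (by linarith) hα0.le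
  have ht1 : (α - 1 - η) / (2 * α) ≤ 1 := (div_le_one hα0).2 (by linarith)
  filter_upwards [eventually_rpow_le_choose_floor ht0 ht1 hη
      (by positivity : 0 < 2 * Real.exp 1) (2 * K),
    tendsto_natCast_atTop_atTop.eventually_ge_atTop (2 * α)] with n hn hn2
  refine (fractionSP_le (by linarith) hn2 hη0 hK hKη ?_).trans
    (Real.exp_le_exp.2 (neg_le_neg hn))
  have hfl := Nat.floor_le (mul_nonneg ht0 (Nat.cast_nonneg n : (0 : ℝ) ≤ n))
  calc 2 * α * (⌊(α - 1 - η) / (2 * α) * n⌋₊ : ℝ)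
      ≤ 2 * α * ((α - 1 - η) / (2 * α) * n) := by gcongr
    _ = n * (α - 1 - η) := by field_simp

end Fraction

end SelfPredicting

theorem mainTheorem1 (α : ℝ) (hα : 1 < α) :
    ∃ r : ℕ → ℝ, r =o[atTop] (fun n : ℕ => (n : ℝ)) ∧
      ∀ n : ℕ, 2 * α ≤ (n : ℝ) →
        SelfPredicting.fractionSP n (1 - 2 * α / (n : ℝ)) ≤
          Real.exp (-(2 : ℝ) ^ ((n : ℝ) * SelfPredicting.binEnt ((α - 1) / (2 * α)) + r n)) := by
  exact SelfPredicting.exists_isLittleO_exponent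
    (fun n => SelfPredicting.fractionSP n (1 - 2 * α / (n : ℝ))) _ (fun n => 2 * α ≤ (n : ℝ))
    (fun _ hn => SelfPredicting.fractionSP_lt_one hα hn)
    (tendsto_natCast_atTop_atTop.eventually_ge_atTop (2 * α))
    (fun _ hε => SelfPredicting.eventually_fractionSP_le hα hε)
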